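/- Let $n,m,r\ge 0$ be integers with $r\le m$. Let $Gr(m-r,m)=\mathbb{R}^{m,m-r}_*/GL_{m-r}$ be the real Grassmann manifold, i.e. the quotient of the space $\mathbb{R}^{m,m-r}_*$ of real $m\times(m-r)$ matrices $Y$ of full column rank $m-r$ by right multiplication by invertible $(m-r)\times(m-r)$ matrices. It carries the quotient topology and the smooth structure given by the standard affine charts, in which, after a reordering of the rows, $Y$ is represented by $\begin{bmatrix} I_{m-r}\\ Y_\alpha\end{bmatrix}$ with coordinates $Y_\alpha\in\mathbb{R}^{r\times(m-r)}$. For $A\in\mathbb{R}^{n\times m}$ the condition $AY=0$ depends only on the class of $Y$ in $Gr(m-r,m)$. Then the set $$\widehat{\mathcal{M}}_r=\{(A,Y)\in\mathbb{R}^{n\times m}\times Gr(m-r,m) : AY=0\}$$ is a smooth ($C^\infty$) manifold of dimension $(n+m)r-r^2$. More precisely, with the subspace topology it is Hausdorff and second countable, and it has a $C^\infty$ structure modelled on $\mathbb{R}^{(n+m)r-r^2}$ for which the inclusion into $\mathbb{R}^{n\times m}\times Gr(m-r,m)$ is a smooth embedding. -/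

import Mathlib

open scoped Manifold ContDiff Matrix
open Manifold

noncomputable section

namespace RankDesing

/-- The vector space `ℝ^{a × b}` of real `a × b` matrices as a normed space. The type is that of
`Matrix (Fin a) (Fin b) ℝ`, unfolded, so that the norm (sup of the entries) and the usual topology
are found by instance search; all norms on it are equivalent, so smoothness does not depend on the
choice. -/
abbrev MatSpace (a b : ℕ) : Type := Fin a → Fin b → ℝ

/-- The noncompact Stiefel manifold: real `m × k` matrices of full (column) rank `k`. -/
abbrev Stiefel (k m : ℕ) : Type :=
  {Y : Matrix (Fin m) (Fin k) ℝ // Y.rank = k}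

/-- Two full rank matrices are equivalent when they differ by right multiplication by an element
of `GL_k`. -/
instance stiefelSetoid (k m : ℕ) : Setoid (Stiefel k m) where
  r Y Y' := ∃ g : GL (Fin k) ℝ, Y'.1 = Y.1 * (g : Matrix (Fin k) (Fin k) ℝ)
  iseqv :=
    { refl := fun Y => ⟨1, by simp⟩
      symm := by
        rintro Y Y' ⟨g, h⟩
        refine ⟨g⁻¹, ?_⟩
        rw [h, Matrix.mul_assoc, ← Units.val_mul, mul_inv_cancel]
        simp
      trans := by
        rintro Y Y' Y'' ⟨g, h⟩ ⟨g', h'⟩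
        exact ⟨g * g', by rw [h', h, Units.val_mul, Matrix.mul_assoc]⟩ }

/-- The Grassmann manifold `Gr(k, m)`: the quotient of the noncompact Stiefel manifold by `GL_k`. -/
def Gr (k m : ℕ) : Type := Quotient (stiefelSetoid k m)

/-- `Gr(k, m)` carries the quotient topology. -/
instance (k m : ℕ) : TopologicalSpace (Gr k m) :=
  inferInstanceAs (TopologicalSpace (Quotient (stiefelSetoid k m)))

/-- The class of a full rank matrix in the Grassmann manifold. -/
def Gr.mk {k m : ℕ} (Y : Stiefel k m) : Gr k m := Quotient.mk _ Y

/-- The condition `A Y = 0` for `Y` a point of the Grassmann manifold; it does not depend on the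
representative. -/
def Gr.Annihilates {n k m : ℕ} (A : Matrix (Fin n) (Fin m) ℝ) (y : Gr k m) : Prop :=
  Quotient.liftOn y (fun Y : Stiefel k m => A * Y.1 = 0) (by
    rintro Y Y' ⟨g, h⟩
    refine propext ⟨fun hA => ?_, fun hA => ?_⟩
    · rw [h, ← Matrix.mul_assoc, hA, Matrix.zero_mul]
    · have hY : Y.1 = Y'.1 * ((g⁻¹ : GL (Fin k) ℝ) : Matrix (Fin k) (Fin k) ℝ) := by
        rw [h, Matrix.mul_assoc, ← Units.val_mul, mul_inv_cancel]
        simp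
      change A * Y.1 = 0
      rw [hY, ← Matrix.mul_assoc, hA, Matrix.zero_mul])

section Charts

variable {k m : ℕ}

/-- The `k` rows of `Y` selected by `e`. -/
def topBlock (e : Fin k ⊕ Fin (m - k) ≃ Fin m) (Y : Matrix (Fin m) (Fin k) ℝ) :
    Matrix (Fin k) (Fin k) ℝ :=
  Y.submatrix (fun i => e (Sum.inl i)) id

/-- The remaining `m - k` rows of `Y`. -/
def botBlock (e : Fin k ⊕ Fin (m - k) ≃ Fin m) (Y : Matrix (Fin m) (Fin k) ℝ) :
    Matrix (Fin (m - k)) (Fin k) ℝ :=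
  Y.submatrix (fun i => e (Sum.inr i)) id

/-- The matrix whose rows are, up to the reordering `e`, those of the block matrix `[I; X]`. -/
def stdMatrix (e : Fin k ⊕ Fin (m - k) ≃ Fin m) (X : Matrix (Fin (m - k)) (Fin k) ℝ) :
    Matrix (Fin m) (Fin k) ℝ :=
  (Matrix.fromRows 1 X).submatrix e.symm id

theorem topBlock_mul (e : Fin k ⊕ Fin (m - k) ≃ Fin m) (Y : Matrix (Fin m) (Fin k) ℝ)
    (g : Matrix (Fin k) (Fin k) ℝ) : topBlock e (Y * g) = topBlock e Y * g := rfl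

theorem botBlock_mul (e : Fin k ⊕ Fin (m - k) ≃ Fin m) (Y : Matrix (Fin m) (Fin k) ℝ)
    (g : Matrix (Fin k) (Fin k) ℝ) : botBlock e (Y * g) = botBlock e Y * g := rfl

@[simp] theorem topBlock_stdMatrix (e : Fin k ⊕ Fin (m - k) ≃ Fin m)
    (X : Matrix (Fin (m - k)) (Fin k) ℝ) : topBlock e (stdMatrix e X) = 1 := by
  ext i j; simp [topBlock, stdMatrix]

@[simp] theorem botBlock_stdMatrix (e : Fin k ⊕ Fin (m - k) ≃ Fin m)
    (X : Matrix (Fin (m - k)) (Fin k) ℝ) : botBlock e (stdMatrix e X) = X := by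
  ext i j; simp [botBlock, stdMatrix]

theorem ext_blocks (e : Fin k ⊕ Fin (m - k) ≃ Fin m) {Y Z : Matrix (Fin m) (Fin k) ℝ}
    (h₁ : topBlock e Y = topBlock e Z) (h₂ : botBlock e Y = botBlock e Z) : Y = Z := by
  ext i j
  obtain ⟨s, rfl⟩ := e.surjective i
  rcases s with s | s
  · exact congrFun (congrFun h₁ s) j
  · exact congrFun (congrFun h₂ s) j

theorem rank_stdMatrix (e : Fin k ⊕ Fin (m - k) ≃ Fin m) (X : Matrix (Fin (m - k)) (Fin k) ℝ) :
    (stdMatrix e X).rank = k := by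
  refine le_antisymm (by simpa using Matrix.rank_le_card_width (stdMatrix e X)) ?_
  have h := Matrix.rank_submatrix_le (stdMatrix e X) (fun i : Fin k => e (Sum.inl i)) id
  have h' : (stdMatrix e X).submatrix (fun i : Fin k => e (Sum.inl i)) id = 1 :=
    topBlock_stdMatrix e X
  rw [h', Matrix.rank_one] at h
  simpa using h

/-- The domain `U_e` of the affine chart: the rows selected by `e` form an invertible matrix. -/
def Gr.dom (e : Fin k ⊕ Fin (m - k) ≃ Fin m) : Set (Gr k m) :=
  {y | Quotient.liftOn y (fun Y : Stiefel k m => IsUnit (topBlock e Y.1).det) (by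
    rintro Y Y' ⟨g, h⟩
    have hg : IsUnit (g : Matrix (Fin k) (Fin k) ℝ).det :=
      (Matrix.isUnit_iff_isUnit_det _).1 g.isUnit
    simp [h, topBlock_mul, Matrix.det_mul, hg.ne_zero])}

/-- The coordinates of a point of `Gr(k, m)` in the affine chart `e`: the matrix `X` such that
`Y` and `[I; X]` (rows reordered by `e`) represent the same point. -/
def Gr.coord (e : Fin k ⊕ Fin (m - k) ≃ Fin m) (y : Gr k m) : Matrix (Fin (m - k)) (Fin k) ℝ :=
  Quotient.liftOn y (fun Y : Stiefel k m => botBlock e Y.1 * (topBlock e Y.1)⁻¹) (by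
    rintro Y Y' ⟨g, h⟩
    have hg : IsUnit (g : Matrix (Fin k) (Fin k) ℝ).det :=
      (Matrix.isUnit_iff_isUnit_det _).1 g.isUnit
    simp only [h, topBlock_mul, botBlock_mul, Matrix.mul_inv_rev]
    rw [Matrix.mul_assoc, Matrix.mul_nonsing_inv_cancel_left _ _ hg])

/-- The point of `Gr(k, m)` with coordinates `X` in the affine chart `e`. -/
def Gr.ofCoord (e : Fin k ⊕ Fin (m - k) ≃ Fin m) (X : Matrix (Fin (m - k)) (Fin k) ℝ) : Gr k m :=
  Gr.mk ⟨stdMatrix e X, rank_stdMatrix e X⟩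

theorem Gr.continuous_mk : Continuous (Gr.mk : Stiefel k m → Gr k m) := continuous_quotient_mk'

theorem Gr.isQuotientMap_mk : Topology.IsQuotientMap (Gr.mk : Stiefel k m → Gr k m) :=
  isQuotientMap_quotient_mk'

theorem continuous_topBlock (e : Fin k ⊕ Fin (m - k) ≃ Fin m) :
    Continuous (topBlock e) := continuous_id.matrix_submatrix _ _

theorem continuous_botBlock (e : Fin k ⊕ Fin (m - k) ≃ Fin m) :
    Continuous (botBlock e) := continuous_id.matrix_submatrix _ _

theorem Gr.isOpen_dom (e : Fin k ⊕ Fin (m - k) ≃ Fin m) : IsOpen (Gr.dom e) := by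
  rw [← Gr.isQuotientMap_mk.isOpen_preimage]
  have : Gr.mk ⁻¹' Gr.dom e = {Y : Stiefel k m | (topBlock e Y.1).det ≠ 0} := by
    ext Y; exact isUnit_iff_ne_zero
  rw [this]
  exact isOpen_ne_fun ((continuous_topBlock e).comp continuous_subtype_val).matrix_det
    continuous_const

theorem Gr.ofCoord_mem_dom (e : Fin k ⊕ Fin (m - k) ≃ Fin m)
    (X : Matrix (Fin (m - k)) (Fin k) ℝ) : Gr.ofCoord e X ∈ Gr.dom e := by
  change IsUnit (topBlock e (stdMatrix e X)).det
  simp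

theorem Gr.coord_ofCoord (e : Fin k ⊕ Fin (m - k) ≃ Fin m)
    (X : Matrix (Fin (m - k)) (Fin k) ℝ) : Gr.coord e (Gr.ofCoord e X) = X := by
  change botBlock e (stdMatrix e X) * (topBlock e (stdMatrix e X))⁻¹ = X
  simp

theorem Gr.ofCoord_coord (e : Fin k ⊕ Fin (m - k) ≃ Fin m) {y : Gr k m} (hy : y ∈ Gr.dom e) :
    Gr.ofCoord e (Gr.coord e y) = y := by
  obtain ⟨Y⟩ := y
  have hY' : IsUnit (topBlock e Y.1).det := hy
  refine Quotient.sound ⟨Matrix.GeneralLinearGroup.mk'' (topBlock e Y.1) hY', ?_⟩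
  refine ext_blocks e ?_ ?_
  · change topBlock e Y.1 = topBlock e (stdMatrix e _ * topBlock e Y.1)
    rw [topBlock_mul, topBlock_stdMatrix, Matrix.one_mul]
  · change botBlock e Y.1 =
      botBlock e (stdMatrix e (botBlock e Y.1 * (topBlock e Y.1)⁻¹) * topBlock e Y.1)
    rw [botBlock_mul, botBlock_stdMatrix, Matrix.nonsing_inv_mul_cancel_right _ _ hY']

/-- The affine chart of `Gr(k, m)` determined by `e`. -/
def Gr.chart (e : Fin k ⊕ Fin (m - k) ≃ Fin m) :
    OpenPartialHomeomorph (Gr k m) (MatSpace (m - k) k) where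
  toFun y := Gr.coord e y
  invFun X := Gr.ofCoord e (Matrix.of X)
  source := Gr.dom e
  target := Set.univ
  map_source' _ _ := Set.mem_univ _
  map_target' X _ := Gr.ofCoord_mem_dom e (Matrix.of X)
  left_inv' _ hy := Gr.ofCoord_coord e hy
  right_inv' X _ := Gr.coord_ofCoord e (Matrix.of X)
  open_source := Gr.isOpen_dom e
  open_target := isOpen_univ
  continuousOn_toFun := by
    refine (Gr.isQuotientMap_mk.continuousOn_isOpen_iff (Gr.isOpen_dom e)).2 ?_
    have ht : Continuous fun Y : Stiefel k m => topBlock e Y.1 :=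
      (continuous_topBlock e).comp continuous_subtype_val
    have hb : Continuous fun Y : Stiefel k m => botBlock e Y.1 :=
      (continuous_botBlock e).comp continuous_subtype_val
    have h : ContinuousOn (fun Y : Stiefel k m => botBlock e Y.1 *
        ((topBlock e Y.1).det⁻¹ • (topBlock e Y.1).adjugate)) (Gr.mk ⁻¹' Gr.dom e) := by
      intro Y hY
      have hY' : (topBlock e Y.1).det ≠ 0 := IsUnit.ne_zero hY
      have h₁ : ContinuousAt (fun Y : Stiefel k m => (topBlock e Y.1).det⁻¹) Y :=
        ht.matrix_det.continuousAt.inv₀ hY'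
      have h₂ : ContinuousAt (fun Y : Stiefel k m =>
          (topBlock e Y.1).det⁻¹ • (topBlock e Y.1).adjugate) Y :=
        h₁.smul ht.matrix_adjugate.continuousAt
      have h₃ : Continuous fun p : Matrix (Fin (m - k)) (Fin k) ℝ × Matrix (Fin k) (Fin k) ℝ =>
          p.1 * p.2 := continuous_fst.matrix_mul continuous_snd
      exact (h₃.continuousAt.comp (hb.continuousAt.prodMk h₂)).continuousWithinAt
    refine h.congr fun Y _ => ?_
    change botBlock e Y.1 * (topBlock e Y.1)⁻¹ = _
    rw [Matrix.inv_def, Ring.inverse_eq_inv']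
  continuousOn_invFun := by
    refine Continuous.continuousOn ?_
    refine Gr.continuous_mk.comp (Continuous.subtype_mk ?_ _)
    refine continuous_matrix fun i j => ?_
    rcases h : e.symm i with s | s
    · simp only [stdMatrix, Matrix.submatrix_apply, h, Matrix.fromRows_apply_inl]
      exact continuous_const
    · simp only [stdMatrix, Matrix.submatrix_apply, h, Matrix.fromRows_apply_inr]
      exact continuous_id.matrix_elem _ _

/-- The affine charts cover the Grassmann manifold. -/
theorem Gr.exists_mem_dom (y : Gr k m) : ∃ e : Fin k ⊕ Fin (m - k) ≃ Fin m, y ∈ Gr.dom e := by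
  obtain ⟨Y, hY⟩ := y
  obtain ⟨κ, a, ha, hspan, hli⟩ := exists_linearIndependent' ℝ Y.row
  have : Finite κ := Finite.of_injective a ha
  have := Fintype.ofFinite κ
  have hcard : Fintype.card κ = k := by
    rw [← finrank_span_eq_card hli, hspan, ← Matrix.rank_eq_finrank_span_row, hY]
  let b : κ ≃ Fin k := Fintype.equivFinOfCardEq hcard
  let f : Fin k → Fin m := a ∘ b.symm
  have hf : Function.Injective f := ha.comp b.symm.injective
  have hc : Fintype.card {x // x ∉ Set.range f} = m - k := by
    rw [Fintype.card_subtype_compl]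
    have : Fintype.card {x // x ∈ Set.range f} = k :=
      (Fintype.card_congr (Equiv.ofInjective f hf).symm).trans (Fintype.card_fin k)
    rw [this, Fintype.card_fin]
  classical
  let e : Fin k ⊕ Fin (m - k) ≃ Fin m :=
    (Equiv.sumCongr (Equiv.ofInjective f hf) (Fintype.equivFinOfCardEq hc).symm).trans
      (Equiv.sumCompl (· ∈ Set.range f))
  refine ⟨e, ?_⟩
  change IsUnit (topBlock e Y).det
  rw [← Matrix.isUnit_iff_isUnit_det, ← Matrix.linearIndependent_rows_iff_isUnit]
  exact hli.comp b.symm b.symm.injective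

end Charts

/-- The smooth atlas of the Grassmann manifold given by the affine charts. -/
instance (k m : ℕ) : ChartedSpace (MatSpace (m - k) k) (Gr k m) where
  atlas := Set.range Gr.chart
  chartAt y := Gr.chart (Gr.exists_mem_dom y).choose
  mem_chart_source y := (Gr.exists_mem_dom y).choose_spec
  chart_mem_atlas _ := Set.mem_range_self _

theorem contDiff_entry {a b : ℕ} {N : ℕ∞ω} (i : Fin a) (j : Fin b) :
    ContDiff ℝ N fun X : MatSpace a b => X i j :=
  contDiff_apply_apply ℝ ℝ i j

theorem contDiffOn_matrix {a b : ℕ} {N : ℕ∞ω} {E : Type*} [NormedAddCommGroup E]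
    [NormedSpace ℝ E] {s : Set E} {F : E → MatSpace a b}
    (h : ∀ i j, ContDiffOn ℝ N (fun x => F x i j) s) : ContDiffOn ℝ N F s :=
  contDiffOn_pi.2 fun i => contDiffOn_pi.2 fun j => h i j

theorem contDiff_det {a : ℕ} {N : ℕ∞ω} {E : Type*} [NormedAddCommGroup E]
    [NormedSpace ℝ E] {F : E → Matrix (Fin a) (Fin a) ℝ}
    (h : ∀ i j, ContDiff ℝ N (fun x => F x i j)) : ContDiff ℝ N (fun x => (F x).det) := by
  simp only [Matrix.det_apply]
  exact ContDiff.sum fun σ _ => (contDiff_prod fun i _ => h _ _).const_smul _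

/-- The affine charts are smoothly compatible. -/
instance (k m : ℕ) : IsManifold 𝓘(ℝ, MatSpace (m - k) k) ∞ (Gr k m) := by
  refine isManifold_of_contDiffOn _ _ _ ?_
  rintro _ _ ⟨e, rfl⟩ ⟨e', rfl⟩
  have hstd : ∀ i j, ContDiff ℝ ∞
      fun X : MatSpace (m - k) k => stdMatrix e (Matrix.of X) i j := by
    intro i j
    rcases h : e.symm i with s | s
    · simp only [stdMatrix, Matrix.submatrix_apply, h, Matrix.fromRows_apply_inl]
      exact contDiff_const
    · simp only [stdMatrix, Matrix.submatrix_apply, h, Matrix.fromRows_apply_inr]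
      exact contDiff_entry _ _
  have hdet : ContDiff ℝ ∞ fun X : MatSpace (m - k) k =>
      (topBlock e' (stdMatrix e (Matrix.of X))).det := contDiff_det fun i j => hstd _ _
  have hadj : ∀ i j, ContDiff ℝ ∞ fun X : MatSpace (m - k) k =>
      (topBlock e' (stdMatrix e (Matrix.of X))).adjugate i j := by
    intro i j
    simp only [Matrix.adjugate_apply]
    refine contDiff_det fun p q => ?_
    by_cases hp : p = j
    · subst hp
      simp only [Matrix.updateRow_self]
      exact contDiff_const
    · simp only [Matrix.updateRow_ne hp]
      exact hstd _ _
  have hmain : ContDiffOn ℝ ∞ (fun X : MatSpace (m - k) k =>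
      Matrix.of.symm (botBlock e' (stdMatrix e (Matrix.of X)) *
        (topBlock e' (stdMatrix e (Matrix.of X)))⁻¹))
      {X | (topBlock e' (stdMatrix e (Matrix.of X))).det ≠ 0} := by
    refine contDiffOn_matrix (F := fun X : MatSpace (m - k) k =>
      Matrix.of.symm (botBlock e' (stdMatrix e (Matrix.of X)) *
        (topBlock e' (stdMatrix e (Matrix.of X)))⁻¹)) fun i j => ?_
    simp only [Matrix.of_symm_apply, Matrix.mul_apply, Matrix.inv_def, Ring.inverse_eq_inv', Matrix.smul_apply,
      smul_eq_mul]
    exact ContDiffOn.sum fun l _ => (hstd _ _).contDiffOn.mul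
      ((hdet.contDiffOn.inv fun X hX => hX).mul (hadj _ _).contDiffOn)
  refine hmain.mono ?_
  intro X hX
  simp only [modelWithCornersSelf_coe_symm, Set.preimage_id_eq, id, modelWithCornersSelf_coe,
    Set.range_id, Set.inter_univ] at hX
  have hX' := hX.2
  exact IsUnit.ne_zero (show IsUnit (topBlock e' (stdMatrix e (Matrix.of X))).det from hX')

/-- The desingularization: pairs `(A, Y)` in `ℝ^{n × m} × Gr(m - r, m)` with `A Y = 0`. -/
def desing (n m r : ℕ) : Set (MatSpace n m × Gr (m - r) m) :=
  {p | Gr.Annihilates (Matrix.of p.1) p.2}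

end RankDesing

end

/-! ### Manifold structures obtained from charts that straighten a map. -/

section SliceCharts

/-! Put `k = m - r`. Over an affine chart of the Grassmannian, `Y` is `[I; X]` up to the reordering
`e`; let `C` be the `k` columns of `A` selected by `e` and `B` the others. Then `A Y = 0` reads `C +
B X = 0`, so the locus is a graph over the free parameters `(B, X)`. The shear `(C, B, X) ↦ (C + B
X, B, X)` is a polynomial diffeomorphism with polynomial inverse and carries the locus to the linear
subspace where the first component is zero. Composed with the affine chart it gives slice charts of
the ambient manifold (`ambientChart`), with `(B, X)` as coordinates on the locus
(`Annihilator.chart`). The dimension is `n(m - k) + (m - k)k = nr + r(m - r)`.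

Slice charts settle the rest: `isManifold_ofFamily` deduces compatibility from that of the ambient
charts, and `isImmersionOfComplement_ofFamily` shows that the inclusion is an immersion. The
Hausdorff property and second countability are inherited from the ambient product. The Grassmannian
is Hausdorff because a subspace is determined by its orthogonal projection, and second countable
because finitely many affine charts cover it. -/

/-- Composing a chart of the maximal atlas with an element of the structure groupoid gives a chart
of the maximal atlas. -/
theorem StructureGroupoid.trans_mem_maximalAtlas {H M : Type*} [TopologicalSpace H]
    [TopologicalSpace M] [ChartedSpace H M] {G : StructureGroupoid H}
    {e : OpenPartialHomeomorph M H} (he : e ∈ G.maximalAtlas M)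
    {d : OpenPartialHomeomorph H H} (hd : d ∈ G) : e ≫ₕ d ∈ G.maximalAtlas M := by
  intro e' he'
  constructor
  · rw [OpenPartialHomeomorph.trans_symm_eq_symm_trans_symm, OpenPartialHomeomorph.trans_assoc]
    exact G.trans (G.symm hd) (he e' he').1
  · rw [← OpenPartialHomeomorph.trans_assoc]
    exact G.trans (he e' he').2 hd

/-- The charted space structure given by an indexed family of charts that covers the space. -/
@[reducible] noncomputable def ChartedSpace.ofFamily {ι H M : Type*} [TopologicalSpace H]
    [TopologicalSpace M] (φ : ι → OpenPartialHomeomorph M H)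
    (hφ : ∀ x, ∃ i, x ∈ (φ i).source) : ChartedSpace H M where
  atlas := Set.range φ
  chartAt x := φ (hφ x).choose
  mem_chart_source x := (hφ x).choose_spec
  chart_mem_atlas _ := Set.mem_range_self _

variable {𝕜 : Type*} [NontriviallyNormedField 𝕜]
  {E F E' : Type*} [NormedAddCommGroup E] [NormedSpace 𝕜 E] [NormedAddCommGroup F]
  [NormedSpace 𝕜 F] [NormedAddCommGroup E'] [NormedSpace 𝕜 E']
  {G M N ι : Type*} [TopologicalSpace G] [TopologicalSpace M] [TopologicalSpace N]
  [ChartedSpace G N] {J : ModelWithCorners 𝕜 E' G} {k : ℕ∞ω}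
  {f : M → N} {φ : ι → OpenPartialHomeomorph M E} {ψ : ι → OpenPartialHomeomorph N G}
  {L : ι → (E × F) ≃L[𝕜] E'}

/-- If a family of charts of `M` straightens a map `f` into a manifold with respect to charts of
the maximal atlas of the target, then the charts of the family are smoothly compatible. -/
theorem isManifold_ofFamily (hφ : ∀ x, ∃ i, x ∈ (φ i).source)
    (hψ : ∀ i, ψ i ∈ IsManifold.maximalAtlas J k N)
    (hsource : ∀ i, (φ i).source ⊆ f ⁻¹' (ψ i).source)
    (hf : ∀ i, ∀ x ∈ (φ i).source, (ψ i).extend J (f x) = L i (φ i x, 0)) :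
    letI := ChartedSpace.ofFamily φ hφ
    IsManifold 𝓘(𝕜, E) k M := by
  let _ := ChartedSpace.ofFamily φ hφ
  refine isManifold_of_contDiffOn _ _ _ ?_
  rintro _ _ ⟨i, rfl⟩ ⟨j, rfl⟩
  have hinv : ∀ v ∈ (φ i).target, ((ψ i).extend J).symm (L i (v, 0)) = f ((φ i).symm v) := by
    intro v hv
    have h := hf i _ ((φ i).map_target hv)
    rw [(φ i).right_inv hv] at h
    rw [← h]
    exact (ψ i).extend_left_inv (hsource i ((φ i).map_target hv))
  -- The transition map on `M` is the ambient one restricted to the slice `E × 0` and then projected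
  -- to `E`; it is smooth as a composite of smooth maps.
  have key : ContDiffOn 𝕜 k
      (fun v => ((L j).symm (J.extendCoordChange (ψ i) (ψ j) (L i (v, 0)))).1)
      ((φ i).symm ≫ₕ φ j).source := by
    refine (contDiff_fst.comp (L j).symm.contDiff).comp_contDiffOn
      ((J.contDiffOn_extendCoordChange (hψ i) (hψ j)).comp
        ((L i).contDiff.comp (contDiff_id.prodMk contDiff_const)).contDiffOn ?_)
    intro v hv
    rw [OpenPartialHomeomorph.trans_source] at hv
    have hv₁ : v ∈ (φ i).target := hv.1
    have hv₂ : (φ i).symm v ∈ (φ j).source := hv.2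
    have h := hf i _ ((φ i).map_target hv₁)
    rw [(φ i).right_inv hv₁] at h
    rw [ModelWithCorners.extendCoordChange_source]
    refine ⟨ψ i (f ((φ i).symm v)), ?_, h⟩
    have hs := hsource i ((φ i).map_target hv₁)
    rw [OpenPartialHomeomorph.trans_source]
    refine ⟨(ψ i).map_source hs, ?_⟩
    change (ψ i).symm (ψ i (f ((φ i).symm v))) ∈ (ψ j).source
    rw [(ψ i).left_inv hs]
    exact hsource j hv₂
  have hset : (𝓘(𝕜, E).symm ⁻¹' ((φ i).symm ≫ₕ φ j).source ∩ Set.range 𝓘(𝕜, E)) =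
      ((φ i).symm ≫ₕ φ j).source := by simp
  rw [hset]
  refine key.congr fun v hv => ?_
  rw [OpenPartialHomeomorph.trans_source] at hv
  have h := hf j _ hv.2
  change φ j ((φ i).symm v) =
    ((L j).symm ((ψ j).extend J (((ψ i).extend J).symm (L i (v, 0))))).1
  rw [hinv v hv.1, h, ContinuousLinearEquiv.symm_apply_apply]

/-- A map that is straightened by a family of charts of `M` and charts of the maximal atlas of the
target is an immersion. -/
theorem isImmersionOfComplement_ofFamily (hφ : ∀ x, ∃ i, x ∈ (φ i).source)
    (hψ : ∀ i, ψ i ∈ IsManifold.maximalAtlas J k N)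
    (hsource : ∀ i, (φ i).source ⊆ f ⁻¹' (ψ i).source)
    (hf : ∀ i, ∀ x ∈ (φ i).source, (ψ i).extend J (f x) = L i (φ i x, 0)) :
    letI := ChartedSpace.ofFamily φ hφ
    IsImmersionOfComplement F 𝓘(𝕜, E) J k f := by
  let _ := ChartedSpace.ofFamily φ hφ
  have := isManifold_ofFamily hφ hψ hsource hf
  intro x
  obtain ⟨i, hi⟩ := hφ x
  refine IsImmersionAtOfComplement.mk_of_charts (L i) (φ i) (ψ i) hi (hsource i hi)
    (IsManifold.subset_maximalAtlas ⟨i, rfl⟩) (hψ i) (hsource i) ?_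
  intro v hv
  have hv' : v ∈ (φ i).target := by simpa using hv
  have h := hf i _ ((φ i).map_target hv')
  rw [(φ i).right_inv hv'] at h
  exact h

end SliceCharts

namespace RankDesing

/-! ### The Grassmannian is Hausdorff and second countable. -/

section Grassmannian

variable {k m : ℕ}

theorem isUnit_of_rank_eq {M : Matrix (Fin k) (Fin k) ℝ} (h : M.rank = k) : IsUnit M := by
  rw [← Matrix.linearIndependent_rows_iff_isUnit, linearIndependent_iff_card_eq_finrank_span,
    Fintype.card_fin, Set.finrank, ← Matrix.rank_eq_finrank_span_row, h]

theorem isUnit_det_gram (Y : Stiefel k m) : IsUnit (Y.1ᵀ * Y.1).det :=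
  (Matrix.isUnit_iff_isUnit_det _).1
    (isUnit_of_rank_eq ((Matrix.rank_transpose_mul_self _).trans Y.2))

/-- The matrix of the orthogonal projection onto the column space of a full rank matrix. -/
noncomputable def Stiefel.proj (Y : Stiefel k m) : Matrix (Fin m) (Fin m) ℝ :=
  Y.1 * ((Y.1ᵀ * Y.1)⁻¹ * Y.1ᵀ)

theorem Stiefel.proj_mul_self (Y : Stiefel k m) : Y.proj * Y.1 = Y.1 := by
  rw [Stiefel.proj, Matrix.mul_assoc, Matrix.mul_assoc,
    Matrix.nonsing_inv_mul _ (isUnit_det_gram Y), Matrix.mul_one]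

theorem Stiefel.continuous_proj : Continuous (Stiefel.proj : Stiefel k m → _) := by
  have hg : Continuous fun Y : Stiefel k m => Y.1ᵀ * Y.1 :=
    continuous_subtype_val.matrix_transpose.matrix_mul continuous_subtype_val
  refine continuous_subtype_val.matrix_mul
    (Continuous.matrix_mul ?_ continuous_subtype_val.matrix_transpose)
  simp only [Matrix.inv_def, Ring.inverse_eq_inv']
  exact (hg.matrix_det.inv₀ fun Y => (isUnit_det_gram Y).ne_zero).smul hg.matrix_adjugate

/-- Since `Z = P_Z Z = P_Y Z`, the definition of `P_Y` exhibits `Z` as `Y` times an explicit square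
matrix. That matrix has rank at least that of `Z`, which is `k`, so it is invertible. -/
theorem Stiefel.equiv_of_proj_eq {Y Z : Stiefel k m} (h : Y.proj = Z.proj) : Y ≈ Z := by
  have hZ : Z.1 = Y.1 * ((Y.1ᵀ * Y.1)⁻¹ * Y.1ᵀ * Z.1) := by
    rw [← Matrix.mul_assoc]
    exact (Z.proj_mul_self.symm.trans (by rw [← h]; rfl))
  have hg : IsUnit ((Y.1ᵀ * Y.1)⁻¹ * Y.1ᵀ * Z.1) := by
    refine isUnit_of_rank_eq (le_antisymm (by
      simpa using Matrix.rank_le_card_width ((Y.1ᵀ * Y.1)⁻¹ * Y.1ᵀ * Z.1)) ?_)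
    have hr := Matrix.rank_mul_le_right Y.1 ((Y.1ᵀ * Y.1)⁻¹ * Y.1ᵀ * Z.1)
    rwa [← hZ, Z.2] at hr
  exact ⟨hg.unit, hZ⟩

theorem Stiefel.proj_eq_of_equiv {Y Z : Stiefel k m} (h : Y ≈ Z) : Y.proj = Z.proj := by
  obtain ⟨g, hg⟩ := h
  have hu : IsUnit (g : Matrix (Fin k) (Fin k) ℝ).det :=
    (Matrix.isUnit_iff_isUnit_det _).1 g.isUnit
  have hut : IsUnit ((g : Matrix (Fin k) (Fin k) ℝ)ᵀ).det := by rwa [Matrix.det_transpose]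
  rw [Stiefel.proj, Stiefel.proj, hg]
  generalize (g : Matrix (Fin k) (Fin k) ℝ) = B at hu hut
  -- With this bracketing the inverse of the Gram matrix splits into three factors, the outer two
  -- being `B⁻¹` and `(Bᵀ)⁻¹`, which cancel against `B` and `Bᵀ`.
  have h₁ : (Y.1 * B)ᵀ * (Y.1 * B) = Bᵀ * (Y.1ᵀ * Y.1 * B) := by
    simp only [Matrix.transpose_mul, Matrix.mul_assoc]
  rw [h₁, Matrix.mul_inv_rev, Matrix.mul_inv_rev, Matrix.transpose_mul]
  simp only [Matrix.mul_assoc]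
  rw [Matrix.mul_nonsing_inv_cancel_left _ _ hu, Matrix.nonsing_inv_mul_cancel_left _ _ hut]

/-- The orthogonal projection gives a continuous injection of the quotient into a space of matrices.
-/
instance : T2Space (Gr k m) := by
  let P : Gr k m → Matrix (Fin m) (Fin m) ℝ :=
    Quotient.lift Stiefel.proj fun _ _ => Stiefel.proj_eq_of_equiv
  have hP : Continuous P := Stiefel.continuous_proj.quotient_lift _
  refine T2Space.of_injective_continuous (f := P) ?_ hP
  rintro ⟨Y⟩ ⟨Z⟩ h
  exact Quotient.sound (Stiefel.equiv_of_proj_eq h)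

instance : SecondCountableTopology (Gr k m) := by
  have : ∀ e : Fin k ⊕ Fin (m - k) ≃ Fin m, SecondCountableTopology (Gr.dom e) :=
    fun e => (Gr.chart e).secondCountableTopology_source
  refine TopologicalSpace.secondCountableTopology_of_countable_cover (U := Gr.dom)
    Gr.isOpen_dom ?_
  exact Set.eq_univ_of_forall fun y => Set.mem_iUnion.2 (Gr.exists_mem_dom y)

end Grassmannian

end RankDesing

noncomputable section

namespace RankDesing

/-! ### Slice charts for the locus `A Y = 0`. -/

section SliceCoordinates

variable {n k m d : ℕ}

/-- The matrix with columns `C` and `B`, arranged by `e`, as a linear equivalence. -/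
def joinCols (n : ℕ) (e : Fin k ⊕ Fin (m - k) ≃ Fin m) :
    (MatSpace n (m - k) × MatSpace n k) ≃ₗ[ℝ] MatSpace n m where
  toFun p i j := Sum.elim (p.2 i) (p.1 i) (e.symm j)
  invFun A := (fun i b => A i (e (Sum.inr b)), fun i a => A i (e (Sum.inl a)))
  map_add' p q := by
    ext i j
    rcases h : e.symm j with s | s <;> simp [h]
  map_smul' c p := by
    ext i j
    rcases h : e.symm j with s | s <;> simp [h]
  left_inv p := by ext <;> simp
  right_inv A := by
    ext i j
    obtain ⟨s, rfl⟩ := e.surjective j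
    rcases s with s | s <;> simp

/-- The correction to the columns of `A` that makes up the difference between `A` and the matrix
whose columns selected by `e` are those of `A [I; X]`. -/
def shearTerm (e : Fin k ⊕ Fin (m - k) ≃ Fin m) (A : MatSpace n m) (X : MatSpace (m - k) k) :
    MatSpace n m :=
  fun i j => Sum.elim (fun a => ∑ b, A i (e (Sum.inr b)) * X b a) (fun _ => 0) (e.symm j)

@[simp] theorem shearTerm_inl (e : Fin k ⊕ Fin (m - k) ≃ Fin m) (A : MatSpace n m)
    (X : MatSpace (m - k) k) (i : Fin n) (a : Fin k) :
    shearTerm e A X i (e (Sum.inl a)) = ∑ b, A i (e (Sum.inr b)) * X b a := by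
  simp [shearTerm]

@[simp] theorem shearTerm_inr (e : Fin k ⊕ Fin (m - k) ≃ Fin m) (A : MatSpace n m)
    (X : MatSpace (m - k) k) (i : Fin n) (b : Fin (m - k)) :
    shearTerm e A X i (e (Sum.inr b)) = 0 := by
  simp [shearTerm]

theorem contDiff_shearTerm (e : Fin k ⊕ Fin (m - k) ≃ Fin m) :
    ContDiff ℝ ∞ fun p : MatSpace n m × MatSpace (m - k) k => shearTerm e p.1 p.2 := by
  refine contDiff_pi.2 fun i => contDiff_pi.2 fun j => ?_
  obtain ⟨s, rfl⟩ := e.surjective j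
  rcases s with s | s
  · simp only [shearTerm_inl]
    exact ContDiff.sum fun b _ => ((contDiff_entry _ _).comp contDiff_fst).mul
      ((contDiff_entry _ _).comp contDiff_snd)
  · simp only [shearTerm_inr]
    exact contDiff_const

theorem contDiff_shear (e : Fin k ⊕ Fin (m - k) ≃ Fin m) :
    ContDiff ℝ ∞ fun p : MatSpace n m × MatSpace (m - k) k => (p.1 + shearTerm e p.1 p.2, p.2) :=
  (contDiff_fst.add (contDiff_shearTerm e)).prodMk contDiff_snd

theorem contDiff_shear_symm (e : Fin k ⊕ Fin (m - k) ≃ Fin m) :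
    ContDiff ℝ ∞ fun p : MatSpace n m × MatSpace (m - k) k => (p.1 - shearTerm e p.1 p.2, p.2) :=
  (contDiff_fst.sub (contDiff_shearTerm e)).prodMk contDiff_snd

/-- The correction is computed from the unselected columns and alters only the selected ones, so
adding it leaves its own value unchanged. This is why subtracting it inverts the shear. -/
theorem shearTerm_congr (e : Fin k ⊕ Fin (m - k) ≃ Fin m) {A A' : MatSpace n m}
    (h : ∀ i b, A i (e (Sum.inr b)) = A' i (e (Sum.inr b))) (X : MatSpace (m - k) k) :
    shearTerm e A X = shearTerm e A' X := by
  ext i j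
  obtain ⟨s, rfl⟩ := e.surjective j
  rcases s with s | s <;> simp [h]

/-- The shear that straightens the locus `A [I; X] = 0`. -/
def shear (n : ℕ) (e : Fin k ⊕ Fin (m - k) ≃ Fin m) :
    (MatSpace n m × MatSpace (m - k) k) ≃ₜ (MatSpace n m × MatSpace (m - k) k) where
  toFun p := (p.1 + shearTerm e p.1 p.2, p.2)
  invFun p := (p.1 - shearTerm e p.1 p.2, p.2)
  left_inv p := by
    refine Prod.ext ?_ rfl
    change p.1 + shearTerm e p.1 p.2 - shearTerm e (p.1 + shearTerm e p.1 p.2) p.2 = p.1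
    rw [shearTerm_congr e (A := p.1 + _) (A' := p.1) (by simp), add_sub_cancel_right]
  right_inv p := by
    refine Prod.ext ?_ rfl
    change p.1 - shearTerm e p.1 p.2 + shearTerm e (p.1 - shearTerm e p.1 p.2) p.2 = p.1
    rw [shearTerm_congr e (A := p.1 - _) (A' := p.1) (by simp), sub_add_cancel]
  continuous_toFun := (contDiff_shear e).continuous
  continuous_invFun := (contDiff_shear_symm e).continuous

theorem shear_mem_contDiffGroupoid (e : Fin k ⊕ Fin (m - k) ≃ Fin m) :
    ((shear n e).toOpenPartialHomeomorph :
      OpenPartialHomeomorph (ModelProd (MatSpace n m) (MatSpace (m - k) k)) _) ∈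
      contDiffGroupoid ∞ (𝓘(ℝ, MatSpace n m).prod 𝓘(ℝ, MatSpace (m - k) k)) := by
  rw [contDiffGroupoid, mem_groupoid_of_pregroupoid]
  exact ⟨(contDiff_shear e).contDiffOn, (contDiff_shear_symm e).contDiffOn⟩

/-- A chart of `ℝ^{n × m} × Gr(k, m)` in which the locus `A Y = 0` is a linear subspace. -/
def ambientChart (n : ℕ) (e : Fin k ⊕ Fin (m - k) ≃ Fin m) :
    OpenPartialHomeomorph (MatSpace n m × Gr k m)
      (ModelProd (MatSpace n m) (MatSpace (m - k) k)) :=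
  ((OpenPartialHomeomorph.refl (MatSpace n m)).prod (Gr.chart e)) ≫ₕ
    (shear n e).toOpenPartialHomeomorph

theorem ambientChart_mem_maximalAtlas (e : Fin k ⊕ Fin (m - k) ≃ Fin m) :
    ambientChart n e ∈
      IsManifold.maximalAtlas (𝓘(ℝ, MatSpace n m).prod 𝓘(ℝ, MatSpace (m - k) k)) ∞
        (MatSpace n m × Gr k m) :=
  StructureGroupoid.trans_mem_maximalAtlas
    (IsManifold.mem_maximalAtlas_prod (StructureGroupoid.id_mem_maximalAtlas _)
      (IsManifold.subset_maximalAtlas (Set.mem_range_self e)))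
    (shear_mem_contDiffGroupoid e)

theorem mem_ambientChart_source (e : Fin k ⊕ Fin (m - k) ≃ Fin m) {p : MatSpace n m × Gr k m} :
    p ∈ (ambientChart n e).source ↔ p.2 ∈ Gr.dom e := by
  simp [ambientChart, Gr.chart]

theorem mul_stdMatrix_apply (e : Fin k ⊕ Fin (m - k) ≃ Fin m) (A : MatSpace n m)
    (X : MatSpace (m - k) k) (i : Fin n) (a : Fin k) :
    (Matrix.of A * stdMatrix e (Matrix.of X)) i a =
      A i (e (Sum.inl a)) + ∑ b, A i (e (Sum.inr b)) * X b a := by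
  rw [Matrix.mul_apply, ← e.sum_comp, Fintype.sum_sum_type]
  simp [stdMatrix, Matrix.one_apply]

theorem annihilates_ofCoord_iff (e : Fin k ⊕ Fin (m - k) ≃ Fin m) (A : MatSpace n m)
    (X : MatSpace (m - k) k) :
    Gr.Annihilates (Matrix.of A) (Gr.ofCoord e (Matrix.of X)) ↔
      ∀ i a, A i (e (Sum.inl a)) + ∑ b, A i (e (Sum.inr b)) * X b a = 0 := by
  change Matrix.of A * stdMatrix e (Matrix.of X) = 0 ↔ _
  simp only [← Matrix.ext_iff, mul_stdMatrix_apply, Matrix.zero_apply]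

/-- The locus `A Y = 0` in `ℝ^{n × m} × Gr(k, m)`. -/
abbrev Annihilator (n k m : ℕ) : Type :=
  {p : MatSpace n m × Gr k m // Gr.Annihilates (Matrix.of p.1) p.2}

theorem Annihilator.apply_inl (e : Fin k ⊕ Fin (m - k) ≃ Fin m) (p : Annihilator n k m)
    (hp : p.1.2 ∈ Gr.dom e) (i : Fin n) (a : Fin k) :
    p.1.1 i (e (Sum.inl a)) + ∑ b, p.1.1 i (e (Sum.inr b)) * Gr.chart e p.1.2 b a = 0 := by
  have h := p.2
  rw [← Gr.ofCoord_coord e hp] at h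
  exact (annihilates_ofCoord_iff e _ (Gr.chart e p.1.2)).1 h i a

/-- The coordinates of the locus `A Y = 0`: the columns of `A` not selected by `e`, and the affine
coordinates of `Y`. -/
def Annihilator.chart (e : Fin k ⊕ Fin (m - k) ≃ Fin m) :
    OpenPartialHomeomorph (Annihilator n k m) (MatSpace n (m - k) × MatSpace (m - k) k) where
  toFun p := (fun i b => p.1.1 i (e (Sum.inr b)), Gr.chart e p.1.2)
  -- The inverse shear applied to the slice point with selected columns zero: it puts `-B X` in
  -- those columns.
  invFun v := ⟨(joinCols n e (v.1, 0) - shearTerm e (joinCols n e (v.1, 0)) v.2,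
      Gr.ofCoord e (Matrix.of v.2)), by
    refine (annihilates_ofCoord_iff e _ _).2 fun i a => ?_
    simp [joinCols]⟩
  source := {p | p.1.2 ∈ Gr.dom e}
  target := Set.univ
  map_source' _ _ := Set.mem_univ _
  map_target' v _ := Gr.ofCoord_mem_dom e (Matrix.of v.2)
  left_inv' p hp := by
    refine Subtype.ext (Prod.ext ?_ (Gr.ofCoord_coord e hp))
    ext i j
    obtain ⟨s, rfl⟩ := e.surjective j
    rcases s with s | s
    · have h := p.apply_inl e hp i s
      simp [joinCols]
      linarith
    · simp [joinCols]
  right_inv' v _ := by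
    refine Prod.ext ?_ (Gr.coord_ofCoord e (Matrix.of v.2))
    ext i b
    simp [joinCols]
  open_source := (Gr.isOpen_dom e).preimage (continuous_snd.comp continuous_subtype_val)
  open_target := isOpen_univ
  continuousOn_toFun := by
    refine ContinuousOn.prodMk (Continuous.continuousOn ?_)
      ((Gr.chart e).continuousOn.comp
        (continuous_snd.comp continuous_subtype_val).continuousOn fun p hp => hp)
    have h : Continuous fun p : Annihilator n k m => p.1.1 :=
      continuous_fst.comp continuous_subtype_val
    exact continuous_pi fun i => continuous_pi fun b => continuous_apply_apply i _ |>.comp h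
  continuousOn_invFun := by
    have hX : Continuous fun X : MatSpace (m - k) k => Gr.ofCoord e (Matrix.of X) :=
      continuousOn_univ.1 (Gr.chart e).continuousOn_symm
    have hA : Continuous fun v : MatSpace n (m - k) × MatSpace (m - k) k =>
        joinCols n e (v.1, 0) :=
      (joinCols n e).toLinearMap.continuous_of_finiteDimensional.comp
        (continuous_fst.prodMk continuous_const)
    have hS : Continuous fun v : MatSpace n (m - k) × MatSpace (m - k) k =>
        shearTerm e (joinCols n e (v.1, 0)) v.2 :=
      (contDiff_shearTerm e).continuous.comp (hA.prodMk continuous_snd)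
    exact (Continuous.subtype_mk ((hA.sub hS).prodMk (hX.comp continuous_snd)) _).continuousOn

/-- The slice property: on the locus the sheared selected columns `C + B X` vanish, and the
remaining ambient coordinates are those of `Annihilator.chart`. -/
theorem Annihilator.ambientChart_apply (e : Fin k ⊕ Fin (m - k) ≃ Fin m)
    (p : Annihilator n k m) (hp : p.1.2 ∈ Gr.dom e) :
    ambientChart n e p.1 =
      (joinCols n e ((Annihilator.chart e p).1, 0), (Annihilator.chart e p).2) := by
  refine Prod.ext ?_ rfl
  change p.1.1 + shearTerm e p.1.1 (Gr.chart e p.1.2) =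
    joinCols n e (fun i b => p.1.1 i (e (Sum.inr b)), 0)
  ext i j
  obtain ⟨s, rfl⟩ := e.surjective j
  rcases s with s | s
  · simpa [joinCols] using p.apply_inl e hp i s
  · simp [joinCols]

/-- The linear equivalence sending `((B, X), C)` to the pair of the matrix with columns `C`, `B`
(arranged by `e`) and `X`. -/
def regroup (n : ℕ) (e : Fin k ⊕ Fin (m - k) ≃ Fin m) :
    ((MatSpace n (m - k) × MatSpace (m - k) k) × MatSpace n k) ≃L[ℝ]
      (MatSpace n m × MatSpace (m - k) k) :=
  LinearEquiv.toContinuousLinearEquiv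
    { toFun := fun p => (joinCols n e (p.1.1, p.2), p.1.2)
      invFun := fun q => ((((joinCols n e).symm q.1).1, q.2), ((joinCols n e).symm q.1).2)
      map_add' := fun p q => Prod.ext ((joinCols n e).map_add (p.1.1, p.2) (q.1.1, q.2)) rfl
      map_smul' := fun c p => Prod.ext ((joinCols n e).map_smul c (p.1.1, p.2)) rfl
      left_inv := fun p => by simp
      right_inv := fun q => by simp }

/-- The dimension count for the locus `A Y = 0`. -/
theorem finrank_coordinates (hd : d = n * (m - k) + (m - k) * k) :
    Module.finrank ℝ (EuclideanSpace ℝ (Fin d)) =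
      Module.finrank ℝ (MatSpace n (m - k) × MatSpace (m - k) k) := by
  simp [Module.finrank_pi_fintype, hd]

/-- The charts `Annihilator.chart e`, transported to Euclidean space by a linear isomorphism,
straighten the inclusion with respect to `ambientChart e`. The complement of the slice is the space
`MatSpace n k` of selected columns. -/
theorem exists_isManifold_annihilator (hd : d = n * (m - k) + (m - k) * k) :
    ∃ _ : ChartedSpace (EuclideanSpace ℝ (Fin d)) (Annihilator n k m),
      IsManifold (𝓡 d) ∞ (Annihilator n k m) ∧
      IsSmoothEmbedding (𝓡 d) (𝓘(ℝ, MatSpace n m).prod 𝓘(ℝ, MatSpace (m - k) k)) ∞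
        (Subtype.val : Annihilator n k m → MatSpace n m × Gr k m) := by
  let L : (MatSpace n (m - k) × MatSpace (m - k) k) ≃L[ℝ] EuclideanSpace ℝ (Fin d) :=
    (ContinuousLinearEquiv.ofFinrankEq (finrank_coordinates hd)).symm
  let φ := fun e : Fin k ⊕ Fin (m - k) ≃ Fin m =>
    (Annihilator.chart (n := n) e) ≫ₕ L.toHomeomorph.toOpenPartialHomeomorph
  have hφs : ∀ e p, p ∈ (φ e).source ↔ p.1.2 ∈ Gr.dom e := fun e p => by
    simp [φ, Annihilator.chart]
  have hφ : ∀ p, ∃ e, p ∈ (φ e).source := fun p =>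
    (Gr.exists_mem_dom p.1.2).imp fun e he => (hφs e p).2 he
  have hsource : ∀ e, (φ e).source ⊆ Subtype.val ⁻¹' (ambientChart n e).source :=
    fun e p hp => (mem_ambientChart_source e).2 ((hφs e p).1 hp)
  have hf : ∀ e, ∀ p ∈ (φ e).source,
      (ambientChart n e).extend (𝓘(ℝ, MatSpace n m).prod 𝓘(ℝ, MatSpace (m - k) k)) p.1 =
        ((L.symm.prodCongr (ContinuousLinearEquiv.refl ℝ _)).trans (regroup n e))
          (φ e p, 0) := by
    intro e p hp
    refine (p.ambientChart_apply e ((hφs e p).1 hp)).trans ?_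
    change _ = regroup n e (L.symm (L (Annihilator.chart e p)), 0)
    rw [L.symm_apply_apply]
    rfl
  let _ := ChartedSpace.ofFamily φ hφ
  exact ⟨inferInstance,
    isManifold_ofFamily hφ ambientChart_mem_maximalAtlas hsource hf,
    (isImmersionOfComplement_ofFamily hφ ambientChart_mem_maximalAtlas hsource hf).isImmersion,
    Topology.IsEmbedding.subtypeVal⟩

end SliceCoordinates

end RankDesing

end

theorem mainTheorem1 (n m r : ℕ) (hr : r ≤ m) :
    T2Space (RankDesing.desing n m r) ∧
    SecondCountableTopology (RankDesing.desing n m r) ∧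
    ∃ _ : ChartedSpace (EuclideanSpace ℝ (Fin ((n + m) * r - r ^ 2))) (RankDesing.desing n m r),
      IsManifold (𝓡 ((n + m) * r - r ^ 2)) ∞ (RankDesing.desing n m r) ∧
      IsSmoothEmbedding (𝓡 ((n + m) * r - r ^ 2))
        (𝓘(ℝ, RankDesing.MatSpace n m).prod
          𝓘(ℝ, RankDesing.MatSpace (m - (m - r)) (m - r))) ∞
        (Subtype.val : RankDesing.desing n m r →
          RankDesing.MatSpace n m × RankDesing.Gr (m - r) m) := by
  -- By unfolding, `desing n m r` is `Annihilator n (m - r) m`; only the dimension formula remains.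
  refine ⟨inferInstance, inferInstance, RankDesing.exists_isManifold_annihilator ?_⟩
  -- Writing `m = r + s` removes the truncated subtractions: `m - r` is `s` and `m - (m - r)` is
  -- `r`.
  obtain ⟨s, rfl⟩ := Nat.exists_eq_add_of_le hr
  rw [Nat.add_sub_cancel_left, Nat.add_sub_cancel]
  refine Nat.sub_eq_of_eq_add ?_
  ring
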